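/- Let $n\ge 1$ and let $w=(w_1,\dots,w_n)\in\mathbb{R}^n$ satisfy $w_1\ge w_2\ge\dots\ge w_n>0$ and $w_1\le\sqrt{\sum_k w_k}$. The random graph $G(w)$ on vertex set $\{1,\dots,n\}$ has each unordered pair $\{i,j\}$ (including the self-loops $i=j$) as an edge independently with probability $\bar A_{ij}=w_iw_j/\sum_k w_k$; the version of $G(w)$ without self-loops is obtained by replacing $\bar A_{ii}$ with $0$ for every $i$. Let $A\in\{0,1\}^{n\times n}$ be the realized symmetric adjacency matrix. Let $\|\cdot\|$ be the Euclidean norm and let $\log$ be the natural logarithm. Let $\varepsilon,\delta\in(0,1)$ and assume that $w$ satisfies $(\varepsilon,\delta)$-concentration, that is, 1. $\frac49\log(2n/\delta)\le w_1\le \|w\|/6$, and 2. $\displaystyle \tilde d:=\frac{\sum_i w_i^2}{\sum_i w_i}\ \ge\ \frac{256\left(\sqrt{4w_1\log(2n/\delta)}+1\right)}{\varepsilon^2}$. Then, both in the model with self-loops and in the model without self-loops, with probability at least $1-\delta$ the following holds: the unit eigenvector $v_1(A)$ belonging to the largest eigenvalue of $A$ is unique up to sign and, for the appropriate choice of sign,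 $$\left\|v_1(A)-\frac{w}{\|w\|}\right\|\le\frac{\varepsilon}{8}.$$ -/

import Mathlib

open MeasureTheory ProbabilityTheory

/-- A symmetric matrix with entries in `[0,1]`: the edge probabilities of a random graph with
independent edges on `n` vertices (the diagonal holds the self-loop probabilities). -/
structure EdgeProbMatrix (n : ℕ) where
  toMatrix : Matrix (Fin n) (Fin n) ℝ
  symm' : ∀ i j, toMatrix i j = toMatrix j i
  mem_Icc' : ∀ i j, toMatrix i j ∈ Set.Icc (0 : ℝ) 1

namespace EdgeProbMatrix

/-- The probability of the (possibly degenerate) unordered pair `s(i, j)`. -/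
def edgeProb {n : ℕ} (P : EdgeProbMatrix n) : Sym2 (Fin n) → unitInterval :=
  Sym2.lift ⟨fun i j => ⟨P.toMatrix i j, P.mem_Icc' i j⟩,
    fun i j => Subtype.ext (P.symm' i j)⟩

/-- The law of the random graph: each unordered pair `e` of vertices, loops included, is
independently an edge (`ω e = true`) with probability `P.edgeProb e`. -/
noncomputable def graphLaw {n : ℕ} (P : EdgeProbMatrix n) : Measure (Sym2 (Fin n) → Bool) :=
  Measure.pi fun e => bernoulliMeasure true false (P.edgeProb e)

/-- The model without self-loops: the diagonal is set to `0`. -/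
def removeLoops {n : ℕ} (P : EdgeProbMatrix n) : EdgeProbMatrix n where
  toMatrix := Matrix.of fun i j => if i = j then 0 else P.toMatrix i j
  symm' i j := by simp [eq_comm, P.symm' i j]
  mem_Icc' i j := by
    by_cases h : i = j
    · simp [h]
    · simpa [h] using P.mem_Icc' i j

end EdgeProbMatrix

/-- The realized `0/1` adjacency matrix of an edge configuration. -/
def adjacencyMatrix {n : ℕ} (ω : Sym2 (Fin n) → Bool) : Matrix (Fin n) (Fin n) ℝ :=
  Matrix.of fun i j => if ω s(i, j) then 1 else 0

/-- Admissible expected degree sequences: positive, in descending order, with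
`w₁ ≤ √(∑ₖ wₖ)`.  The largest entry `w₁` is `w 0`. -/
structure IsExpectedDegreeSequence {n : ℕ} [NeZero n] (w : EuclideanSpace ℝ (Fin n)) : Prop where
  pos : ∀ i, 0 < w i
  antitone : ∀ i j, i ≤ j → w j ≤ w i
  le_sqrt_sum : w 0 ≤ √(∑ k, w k)

/-- The edge probabilities `wᵢ wⱼ / ∑ₖ wₖ` of the `G(w)` model (self-loops allowed). -/
noncomputable def gwModel {n : ℕ} [NeZero n] (w : EuclideanSpace ℝ (Fin n))
    (hw : IsExpectedDegreeSequence w) : EdgeProbMatrix n where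
  toMatrix := Matrix.of fun i j => w i * w j / ∑ k, w k
  symm' i j := by simp [mul_comm]
  mem_Icc' i j := by
    have hs : 0 < ∑ k, w k := Finset.sum_pos (fun k _ => hw.pos k) Finset.univ_nonempty
    have h0 : ∀ k, w k ≤ √(∑ k, w k) := fun k =>
      (hw.antitone 0 k (Fin.zero_le k)).trans hw.le_sqrt_sum
    refine ⟨div_nonneg (mul_nonneg (hw.pos i).le (hw.pos j).le) hs.le, ?_⟩
    rw [Matrix.of_apply, div_le_one hs]
    calc w i * w j ≤ √(∑ k, w k) * √(∑ k, w k) :=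
          mul_le_mul (h0 i) (h0 j) (hw.pos j).le (Real.sqrt_nonneg _)
      _ = ∑ k, w k := Real.mul_self_sqrt hs.le

/-- `(ε, δ)`-concentration of the `G(w)` model. -/
structure GWConcentration {n : ℕ} [NeZero n] (w : EuclideanSpace ℝ (Fin n)) (ε δ : ℝ) :
    Prop where
  eps_mem : ε ∈ Set.Ioo (0 : ℝ) 1
  delta_mem : δ ∈ Set.Ioo (0 : ℝ) 1
  le_max_degree : 4 / 9 * Real.log (2 * n / δ) ≤ w 0
  max_degree_le : w 0 ≤ ‖w‖ / 6
  le_second_order_average :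
    256 * (√(4 * w 0 * Real.log (2 * n / δ)) + 1) / ε ^ 2 ≤ (∑ i, w i ^ 2) / ∑ i, w i

/-- `v` is a unit (Euclidean norm) eigenvector of `A` for the largest eigenvalue of `A`. -/
def IsTopUnitEigenvector {n : ℕ} (A : Matrix (Fin n) (Fin n) ℝ)
    (v : EuclideanSpace ℝ (Fin n)) : Prop :=
  ‖v‖ = 1 ∧ ∃ l : ℝ,
    IsGreatest {μ : ℝ | Module.End.HasEigenvalue (Matrix.toEuclideanLin A) μ} l ∧
      Matrix.toEuclideanLin A v = l • v

/-- The top unit eigenvector of `A` is well defined up to sign and, with the appropriate choice of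
sign, lies within (Euclidean) distance `r` of `u`. -/
def TopEigenvectorWithin {n : ℕ} (A : Matrix (Fin n) (Fin n) ℝ)
    (u : EuclideanSpace ℝ (Fin n)) (r : ℝ) : Prop :=
  ∃ v, IsTopUnitEigenvector A v ∧ (∀ v', IsTopUnitEigenvector A v' → v' = v ∨ v' = -v) ∧
    ‖v - u‖ ≤ r

/-! The expected matrix of `G(w)` is `d̃ u uᵀ` with `u = w/‖w‖`, of rank one with gap `d̃`. In
either model the realized matrix is, with probability at least `1 - δ`, within `η = 5√(4 w₁
log(2n/δ)) + 1` of it in operator norm; the `1` pays for deleted loops. Since `d̃` is a large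
multiple of `η/ε`, the top eigenvalue stays simple and its eigenvector stays near `u`
(`topEigenvectorWithin_of_rank_one_perturbation`).

The random part is bounded by the trace method (`integral_trace_pow_le`) and Markov. The trace of
the `2k`-th power is a sum over closed walks, whose means vanish when some edge occurs exactly once;
otherwise there are at most `k` distinct edges. A weight `t ≤ 1` per distinct edge then costs at
most `t⁻ᵏ`, and weighted walks are counted step by step: at most `2k` repeats, or a new edge of
total weight at most `t w₁`. -/

/-- The sum, over all walks with `l` steps from `i`, of `F` at the end point of the walk and the
list of the traversed edges prepended to `es`. -/
def walkSum {V : Type*} [Fintype V] (F : V → List (Sym2 V) → ℝ) : ℕ → V → List (Sym2 V) → ℝ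
  | 0, i, es => F i es
  | l + 1, i, es => ∑ j, walkSum F l j (s(i, j) :: es)

/-! ### Walk expansions of matrix powers -/

section WalkSum

variable {V : Type*} [Fintype V]

lemma walkSum_mono {F G : V → List (Sym2 V) → ℝ} (l : ℕ) (i : V) (es : List (Sym2 V))
    (h : ∀ j es', es'.length = es.length + l → F j es' ≤ G j es') :
    walkSum F l i es ≤ walkSum G l i es := by
  induction l generalizing i es with
  | zero => exact h i es rfl
  | succ l ih =>
    refine Finset.sum_le_sum fun j _ => ih j _ fun k es' hes => h k es' ?_
    rw [hes, List.length_cons]; ring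

lemma walkSum_prod_eq [DecidableEq V] (X : Sym2 V → ℝ) (i₀ : V) (l : ℕ) (i : V)
    (es : List (Sym2 V)) :
    walkSum (fun j es' => if j = i₀ then (es'.map X).prod else 0) l i es =
      (es.map X).prod * ((Matrix.of fun i j => X s(i, j)) ^ l) i i₀ := by
  induction l generalizing i es with
  | zero => simp [walkSum, Matrix.one_apply]
  | succ l ih =>
    simp only [walkSum, ih, pow_succ', Matrix.mul_apply, List.map_cons, List.prod_cons,
      Finset.mul_sum, Matrix.of_apply]
    exact Finset.sum_congr rfl fun j _ => by ring

lemma integral_walkSum {Ω : Type*} [MeasurableSpace Ω] {μ : Measure Ω}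
    (F : Ω → V → List (Sym2 V) → ℝ) (hF : ∀ j es, Integrable (fun ω => F ω j es) μ)
    (l : ℕ) (i : V) (es : List (Sym2 V)) :
    Integrable (fun ω => walkSum (F ω) l i es) μ ∧
      ∫ ω, walkSum (F ω) l i es ∂μ = walkSum (fun j es' => ∫ ω, F ω j es' ∂μ) l i es := by
  induction l generalizing i es with
  | zero => exact ⟨hF i es, rfl⟩
  | succ l ih =>
    simp only [walkSum]
    refine ⟨integrable_finsetSum _ fun j _ => (ih j _).1, ?_⟩
    rw [integral_finsetSum _ fun j _ => (ih j _).1]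
    exact Finset.sum_congr rfl fun j _ => (ih j _).2

lemma walkSum_const_mul (c : ℝ) (F : V → List (Sym2 V) → ℝ) (l : ℕ) (i : V)
    (es : List (Sym2 V)) :
    walkSum (fun j es' => c * F j es') l i es = c * walkSum F l i es := by
  induction l generalizing i es with
  | zero => rfl
  | succ l ih => simp only [walkSum, ih, Finset.mul_sum]

variable [DecidableEq V]

lemma card_filter_mk_mem_le (i : V) (es : List (Sym2 V)) :
    (Finset.univ.filter fun j => s(i, j) ∈ es).card ≤ es.length := by
  refine le_trans ?_ es.toFinset_card_le
  refine Finset.card_le_card_of_injOn (fun j => s(i, j)) (fun j hj => ?_) fun a _ b _ hab => ?_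
  · simpa using hj
  · simpa using (Sym2.congr_right (a := i)).1 hab

/-- Each step of a walk either repeats one of the earlier edges or is new; this bounds the weighted
number of walks, where a walk is weighted by the product of `q` over its distinct edges. -/
lemma walkSum_prod_toFinset_le {q : Sym2 V → ℝ} (hq : ∀ e, 0 ≤ q e) {d : ℝ}
    (hd : ∀ i, ∑ j, q s(i, j) ≤ d) {N : ℕ} (l : ℕ) (i : V) (es : List (Sym2 V))
    (hN : es.length + l ≤ N) :
    walkSum (fun _ es' => ∏ e ∈ es'.toFinset, q e) l i es ≤
      (∏ e ∈ es.toFinset, q e) * (N + d) ^ l := by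
  have hd0 : 0 ≤ d := (Finset.sum_nonneg fun j _ => hq _).trans (hd i)
  induction l generalizing i es with
  | zero => simp [walkSum]
  | succ l ih =>
    have hG : 0 ≤ ∏ e ∈ es.toFinset, q e := Finset.prod_nonneg fun e _ => hq e
    have step : ∑ j, ∏ e ∈ (s(i, j) :: es).toFinset, q e ≤
        (∏ e ∈ es.toFinset, q e) * (N + d) := by
      calc ∑ j, ∏ e ∈ (s(i, j) :: es).toFinset, q e
          ≤ ∑ j, (∏ e ∈ es.toFinset, q e) * ((if s(i, j) ∈ es then 1 else 0) + q s(i, j)) := by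
            refine Finset.sum_le_sum fun j _ => ?_
            rw [List.toFinset_cons]
            by_cases h : s(i, j) ∈ es
            · rw [Finset.insert_eq_of_mem (List.mem_toFinset.2 h), if_pos h]
              nlinarith [hq s(i, j)]
            · rw [Finset.prod_insert (by simpa using h), if_neg h, zero_add, mul_comm]
        _ = (∏ e ∈ es.toFinset, q e) *
              ((Finset.univ.filter fun j => s(i, j) ∈ es).card + ∑ j, q s(i, j)) := by
            rw [← Finset.mul_sum, Finset.sum_add_distrib, Finset.sum_boole]
        _ ≤ _ := by
            have h1 : ((Finset.univ.filter fun j => s(i, j) ∈ es).card : ℝ) ≤ N := by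
              exact_mod_cast (card_filter_mk_mem_le i es).trans (by omega)
            exact mul_le_mul_of_nonneg_left (add_le_add h1 (hd i)) hG
    calc ∑ j, walkSum (fun _ es' => ∏ e ∈ es'.toFinset, q e) l j (s(i, j) :: es)
        ≤ ∑ j, (∏ e ∈ (s(i, j) :: es).toFinset, q e) * (N + d) ^ l :=
          Finset.sum_le_sum fun j _ => ih j _ (by simp only [List.length_cons]; omega)
      _ ≤ (∏ e ∈ es.toFinset, q e) * (N + d) * (N + d) ^ l := by
          rw [← Finset.sum_mul]
          exact mul_le_mul_of_nonneg_right step (by positivity)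
      _ = _ := by ring

end WalkSum

/-! ### Moments of centred edges and the expected trace -/

/-- The centred indicator of an edge of probability `p`. -/
def centeredEdge (p : ℝ) (b : Bool) : ℝ := (if b then 1 else 0) - p

lemma integral_centeredEdge_pow (p : unitInterval) (m : ℕ) :
    ∫ b, centeredEdge p b ^ m ∂(bernoulliMeasure true false p) =
      p * (1 - p) ^ m + (1 - p) * (-p) ^ m := by
  rw [integral_bernoulliMeasure]
  simp [centeredEdge]

/-- Higher powers only shrink numbers in `[0, 1]`, so the case `m = 2` dominates: the variance `p(1
- p)`. -/
lemma integral_centeredEdge_pow_le (p : unitInterval) {m : ℕ} (hm : 2 ≤ m) :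
    |∫ b, centeredEdge p b ^ m ∂(bernoulliMeasure true false p)| ≤ (p : ℝ) := by
  rw [integral_centeredEdge_pow]
  have h0 : 0 ≤ (p : ℝ) := p.2.1
  have h1 : 0 ≤ 1 - (p : ℝ) := sub_nonneg.2 p.2.2
  have ha : |(p : ℝ) * (1 - p) ^ m| ≤ p * (1 - p) ^ 2 := by
    rw [abs_of_nonneg (by positivity)]
    exact mul_le_mul_of_nonneg_left (pow_le_pow_of_le_one h1 (by linarith) hm) h0
  have hb : |(1 - (p : ℝ)) * (-p) ^ m| ≤ (1 - p) * p ^ 2 := by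
    rw [abs_mul, abs_pow, abs_neg, abs_of_nonneg h0, abs_of_nonneg h1]
    exact mul_le_mul_of_nonneg_left (pow_le_pow_of_le_one h0 p.2.2 hm) h1
  refine (abs_add_le _ _).trans ((add_le_add ha hb).trans ?_)
  nlinarith

section GraphLaw

variable {n : ℕ} (P : EdgeProbMatrix n)

instance : IsProbabilityMeasure P.graphLaw := by
  unfold EdgeProbMatrix.graphLaw
  infer_instance

lemma edgeProb_mk (i j : Fin n) : (P.edgeProb s(i, j) : ℝ) = P.toMatrix i j := rfl

lemma integrable_graphLaw (f : (Sym2 (Fin n) → Bool) → ℝ) : Integrable f P.graphLaw :=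
  Integrable.of_finite

/-- A product of centred edge indicators has mean zero if some edge occurs just once, and otherwise
its mean is at most the product of the probabilities of the distinct edges. -/
lemma integral_prod_centeredEdge_le {t : ℝ} (ht : 0 < t) (ht1 : t ≤ 1) {k : ℕ}
    (es : List (Sym2 (Fin n))) (hes : es.length = 2 * k) :
    ∫ ω, (es.map fun e => centeredEdge (P.edgeProb e) (ω e)).prod ∂P.graphLaw ≤
      (t ^ k)⁻¹ * ∏ e ∈ es.toFinset, t * P.edgeProb e := by
  have hnn : 0 ≤ (t ^ k)⁻¹ * ∏ e ∈ es.toFinset, t * (P.edgeProb e : ℝ) :=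
    mul_nonneg (by positivity)
      (Finset.prod_nonneg fun e _ => mul_nonneg ht.le (P.edgeProb e).2.1)
  have hprod : ∀ ω : Sym2 (Fin n) → Bool,
      (es.map fun e => centeredEdge (P.edgeProb e) (ω e)).prod =
        ∏ e, centeredEdge (P.edgeProb e) (ω e) ^ es.count e := fun ω => by
    rw [Finset.prod_list_map_count]
    refine Finset.prod_subset (Finset.subset_univ _) fun e _ he => ?_
    rw [List.count_eq_zero_of_not_mem (by simpa using he), pow_zero]
  simp only [hprod]
  rw [EdgeProbMatrix.graphLaw, integral_fintype_prod_eq_prod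
    (f := fun e b => centeredEdge (P.edgeProb e) b ^ es.count e)]
  by_cases h1 : ∃ e, es.count e = 1
  · obtain ⟨e, he⟩ := h1
    rw [Finset.prod_eq_zero (Finset.mem_univ e)]
    · exact hnn
    · rw [integral_centeredEdge_pow, he]; ring
  push Not at h1
  have h2 : ∀ e ∈ es.toFinset, 2 ≤ es.count e := fun e he => by
    have := List.count_pos_iff.2 (List.mem_toFinset.1 he)
    have := h1 e
    omega
  have hcard : es.toFinset.card ≤ k := by
    have h3 := Finset.card_nsmul_le_sum es.toFinset (fun e => es.count e) 2 h2
    rw [List.sum_toFinset_count_eq_length, hes, smul_eq_mul] at h3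
    omega
  rw [← Finset.prod_subset (Finset.subset_univ es.toFinset) fun e _ he => by
    rw [List.count_eq_zero_of_not_mem (by simpa using he)]; simp]
  calc ∏ e ∈ es.toFinset, ∫ b, centeredEdge (P.edgeProb e) b ^ es.count e
          ∂(bernoulliMeasure true false (P.edgeProb e))
      ≤ ∏ e ∈ es.toFinset, (P.edgeProb e : ℝ) := by
        refine (le_abs_self _).trans ?_
        rw [Finset.abs_prod]
        exact Finset.prod_le_prod (fun _ _ => abs_nonneg _) fun e he =>
          integral_centeredEdge_pow_le _ (h2 e he)
    -- At most `k` distinct edges and `t ≤ 1`, so `t ^ card ≥ t ^ k`.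
    _ ≤ (t ^ k)⁻¹ * (t ^ es.toFinset.card * ∏ e ∈ es.toFinset, (P.edgeProb e : ℝ)) := by
        rw [← mul_assoc]
        refine le_mul_of_one_le_left (Finset.prod_nonneg fun e _ => (P.edgeProb e).2.1) ?_
        rw [inv_mul_eq_div, one_le_div (by positivity)]
        exact pow_le_pow_of_le_one ht.le ht1 hcard
    _ = _ := by rw [Finset.prod_mul_distrib, Finset.prod_const]

lemma adjacencyMatrix_sub_eq (ω : Sym2 (Fin n) → Bool) :
    adjacencyMatrix ω - P.toMatrix =
      Matrix.of fun i j => centeredEdge (P.edgeProb s(i, j)) (ω s(i, j)) := by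
  ext i j
  simp [adjacencyMatrix, centeredEdge, edgeProb_mk]

/-- The expected trace of an even power of the centred adjacency matrix. -/
lemma integral_trace_pow_le {d : ℝ} (hd : ∀ i, ∑ j, P.toMatrix i j ≤ d) {t : ℝ} (ht : 0 < t)
    (ht1 : t ≤ 1) (k : ℕ) :
    ∫ ω, ((adjacencyMatrix ω - P.toMatrix) ^ (2 * k)).trace ∂P.graphLaw ≤
      n * ((t ^ k)⁻¹ * (2 * k + t * d) ^ (2 * k)) := by
  let X : (Sym2 (Fin n) → Bool) → Sym2 (Fin n) → ℝ :=
    fun ω e => centeredEdge (P.edgeProb e) (ω e)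
  have hentry : ∀ (ω : Sym2 (Fin n) → Bool) i,
      ((adjacencyMatrix ω - P.toMatrix) ^ (2 * k)) i i =
        walkSum (fun j es => if j = i then (es.map (X ω)).prod else 0) (2 * k) i [] := fun ω i => by
    rw [walkSum_prod_eq, adjacencyMatrix_sub_eq]; simp [X]
  simp only [Matrix.trace, Matrix.diag_apply, hentry]
  rw [integral_finsetSum _ fun i _ => integrable_graphLaw P _]
  refine (Finset.sum_le_card_nsmul _ _ _ fun i _ => ?_).trans_eq
    (by rw [Finset.card_univ, Fintype.card_fin, nsmul_eq_mul])
  rw [(integral_walkSum _ (fun _ _ => integrable_graphLaw P _) _ _ _).2]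
  -- The walk need no longer close up: other endpoints contribute `0`, below the nonnegative weight.
  refine (walkSum_mono (G := fun _ es => (t ^ k)⁻¹ * ∏ e ∈ es.toFinset, t * (P.edgeProb e : ℝ))
    _ _ _ fun j es hes => ?_).trans ?_
  · split_ifs
    · exact integral_prod_centeredEdge_le P ht ht1 es (by simpa using hes)
    · simpa using mul_nonneg (by positivity : 0 ≤ (t ^ k)⁻¹)
        (Finset.prod_nonneg fun e _ => mul_nonneg ht.le (P.edgeProb e).2.1)
  · rw [walkSum_const_mul]
    refine mul_le_mul_of_nonneg_left ?_ (by positivity)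
    refine (walkSum_prod_toFinset_le (q := fun e => t * (P.edgeProb e : ℝ)) (d := t * d)
      (N := 2 * k) (fun e => mul_nonneg ht.le (P.edgeProb e).2.1) (fun i => ?_) _ _ _
      (by simp)).trans_eq (by simp)
    rw [← Finset.mul_sum]
    exact mul_le_mul_of_nonneg_left (hd i) ht.le

end GraphLaw

/-! ### Spectral perturbation of a rank one matrix -/

section Perturbation

variable {n : ℕ}

lemma inner_toEuclideanLin_comm {A : Matrix (Fin n) (Fin n) ℝ} (hA : A.IsHermitian)
    (x y : EuclideanSpace ℝ (Fin n)) :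
    inner ℝ (Matrix.toEuclideanLin A x) y = inner ℝ x (Matrix.toEuclideanLin A y) :=
  Matrix.isSymmetric_toEuclideanLin_iff.2 hA x y

lemma trace_pow_eq_sum_eigenvalues_pow {A : Matrix (Fin n) (Fin n) ℝ} (hA : A.IsHermitian)
    (m : ℕ) : (A ^ m).trace = ∑ i, hA.eigenvalues i ^ m := by
  conv_lhs => rw [hA.spectral_theorem, ← map_pow, Matrix.diagonal_pow]
  rw [Unitary.conjStarAlgAut_apply, Matrix.trace_mul_comm, ← mul_assoc]
  simp [Matrix.trace_diagonal]

lemma toEuclideanLin_eigenvectorBasis {A : Matrix (Fin n) (Fin n) ℝ} (hA : A.IsHermitian)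
    (i : Fin n) : Matrix.toEuclideanLin A (hA.eigenvectorBasis i) =
      hA.eigenvalues i • hA.eigenvectorBasis i := by
  ext j
  simpa using congrFun (hA.mulVec_eigenvectorBasis i) j

lemma inner_eigenvectorBasis_toEuclideanLin {A : Matrix (Fin n) (Fin n) ℝ} (hA : A.IsHermitian)
    (i : Fin n) (x : EuclideanSpace ℝ (Fin n)) :
    inner ℝ (hA.eigenvectorBasis i) (Matrix.toEuclideanLin A x) =
      hA.eigenvalues i * inner ℝ (hA.eigenvectorBasis i) x := by
  rw [← inner_toEuclideanLin_comm hA, toEuclideanLin_eigenvectorBasis, real_inner_smul_left]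

/-- The trace is a sum of even powers of eigenvalues, so it dominates each one. -/
lemma norm_toEuclideanLin_le_of_trace_pow_le {A : Matrix (Fin n) (Fin n) ℝ} (hA : A.IsHermitian)
    {k : ℕ} (hk : k ≠ 0) {r : ℝ} (hr : 0 ≤ r) (htr : (A ^ (2 * k)).trace ≤ r ^ (2 * k))
    (x : EuclideanSpace ℝ (Fin n)) : ‖Matrix.toEuclideanLin A x‖ ≤ r * ‖x‖ := by
  have hev : ∀ i, hA.eigenvalues i ^ 2 ≤ r ^ 2 := fun i => by
    refine le_of_pow_le_pow_left₀ hk (by positivity) ?_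
    rw [← pow_mul, ← pow_mul]
    refine le_trans ?_ htr
    rw [trace_pow_eq_sum_eigenvalues_pow hA]
    exact Finset.single_le_sum (f := fun i => hA.eigenvalues i ^ (2 * k))
      (fun j _ => by rw [pow_mul]; positivity) (Finset.mem_univ i)
  refine abs_le_of_sq_le_sq' ?_ (by positivity) |>.2
  rw [mul_pow, ← hA.eigenvectorBasis.sum_sq_norm_inner_right,
    ← hA.eigenvectorBasis.sum_sq_norm_inner_right, Finset.mul_sum]
  refine Finset.sum_le_sum fun i _ => ?_
  rw [inner_eigenvectorBasis_toEuclideanLin, norm_mul, mul_pow, Real.norm_eq_abs, sq_abs]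
  exact mul_le_mul_of_nonneg_right (hev i) (by positivity)

/-- The largest eigenvalue of a real symmetric matrix, with a unit eigenvector; it bounds the
quadratic form from above. -/
lemma exists_isGreatest_eigenvalue [NeZero n] {A : Matrix (Fin n) (Fin n) ℝ}
    (hA : A.IsHermitian) :
    ∃ (l : ℝ) (v : EuclideanSpace ℝ (Fin n)), ‖v‖ = 1 ∧
      IsGreatest {μ : ℝ | Module.End.HasEigenvalue (Matrix.toEuclideanLin A) μ} l ∧
      Matrix.toEuclideanLin A v = l • v ∧
      ∀ x, inner ℝ x (Matrix.toEuclideanLin A x) ≤ l * ‖x‖ ^ 2 := by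
  obtain ⟨i, hi⟩ := Finite.exists_max hA.eigenvalues
  have hnorm : ‖hA.eigenvectorBasis i‖ = 1 := hA.eigenvectorBasis.orthonormal.1 i
  have hform : ∀ x, inner ℝ x (Matrix.toEuclideanLin A x) ≤ hA.eigenvalues i * ‖x‖ ^ 2 := by
    intro x
    rw [← hA.eigenvectorBasis.sum_inner_mul_inner, ← hA.eigenvectorBasis.sum_sq_norm_inner_right,
      Finset.mul_sum]
    refine Finset.sum_le_sum fun j _ => ?_
    rw [inner_eigenvectorBasis_toEuclideanLin, Real.norm_eq_abs, sq_abs, real_inner_comm]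
    nlinarith [hi j, sq_nonneg (inner ℝ (hA.eigenvectorBasis j) x)]
  refine ⟨hA.eigenvalues i, hA.eigenvectorBasis i, hnorm, ⟨?_, ?_⟩,
    toEuclideanLin_eigenvectorBasis hA i, hform⟩
  · refine Module.End.hasEigenvalue_of_hasEigenvector (x := hA.eigenvectorBasis i)
      ⟨Module.End.mem_eigenspace_iff.2 (toEuclideanLin_eigenvectorBasis hA i), ?_⟩
    exact norm_ne_zero_iff.1 (by rw [hnorm]; exact one_ne_zero)
  · intro μ hμ
    obtain ⟨x, hx⟩ := hμ.exists_hasEigenvector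
    have h := hform x
    rw [hx.apply_eq_smul, real_inner_smul_right, real_inner_self_eq_norm_sq] at h
    exact le_of_mul_le_mul_right h (by have := norm_pos_iff.2 hx.2; positivity)

/-- The top eigenvector of a small perturbation of the rank one matrix `D u uᵀ` is close to `u`. -/
lemma topEigenvectorWithin_of_rank_one_perturbation [NeZero n] {A : Matrix (Fin n) (Fin n) ℝ}
    (hA : A.IsHermitian) {u : EuclideanSpace ℝ (Fin n)} (hu : ‖u‖ = 1) {D η r : ℝ}
    (hη : 2 * η < D) (hr0 : 0 ≤ r) (hr : 2 * η ≤ r * (D - η))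
    (hF : ∀ x, ‖Matrix.toEuclideanLin A x - (D * inner ℝ u x) • u‖ ≤ η * ‖x‖) :
    TopEigenvectorWithin A u r := by
  set T := Matrix.toEuclideanLin A
  obtain ⟨l, v₀, hv₀, hl, hTv₀, hform⟩ := exists_isGreatest_eigenvalue hA
  have hη0 : 0 ≤ η := by simpa [hu] using (norm_nonneg _).trans (hF u)
  have huu : inner ℝ u u = 1 := by rw [real_inner_self_eq_norm_sq, hu, one_pow]
  have hDl : D - η ≤ l := by
    have h1 := hform u
    have h2 := hF u
    have h3 := abs_real_inner_le_norm u (T u - (D * inner ℝ u u) • u)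
    rw [inner_sub_right, real_inner_smul_right, huu, hu] at h3
    rw [huu, hu] at h2
    rw [hu] at h1
    have := neg_abs_le (inner ℝ u (T u) - D * 1 * 1)
    linarith
  have hηl : η < l := by linarith
  -- On `uᗮ` the matrix has norm at most `η < l`, so no `l`-eigenvector lies there; hence the
  -- eigenspace is a line.
  have horth : ∀ x, T x = l • x → inner ℝ u x = 0 → x = 0 := by
    intro x hx hux
    have h := hF x
    rw [hx, hux, mul_zero, zero_smul, sub_zero, norm_smul, Real.norm_eq_abs,
      abs_of_nonneg (by linarith)] at h
    by_contra hne
    have := norm_pos_iff.2 hne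
    nlinarith
  obtain ⟨v, hv, hTv, hc⟩ : ∃ v, ‖v‖ = 1 ∧ T v = l • v ∧ 0 ≤ inner ℝ u v := by
    rcases le_total 0 (inner ℝ u v₀) with h | h
    · exact ⟨v₀, hv₀, hTv₀, h⟩
    · exact ⟨-v₀, by rwa [norm_neg], by rw [map_neg, hTv₀, smul_neg], by
        rw [inner_neg_right]; linarith⟩
  have hvv : inner ℝ v v = 1 := by rw [real_inner_self_eq_norm_sq, hv, one_pow]
  refine ⟨v, ⟨hv, l, hl, hTv⟩, ?_, ?_⟩
  · rintro v' ⟨hv', l', hl', hTv'⟩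
    obtain rfl : l' = l := hl'.unique hl
    have hv'v' : inner ℝ v' v' = 1 := by rw [real_inner_self_eq_norm_sq, hv', one_pow]
    have h0 := horth (inner ℝ u v • v' - inner ℝ u v' • v)
      (by rw [map_sub, map_smul, map_smul, hTv, hTv', smul_sub, smul_comm, smul_comm l' _ v])
      (by rw [inner_sub_right, real_inner_smul_right, real_inner_smul_right]; ring)
    have hne : inner ℝ u v ≠ 0 := fun h => by
      have := horth v hTv h
      rw [this, norm_zero] at hv
      exact zero_ne_one hv
    rw [sub_eq_zero] at h0
    have habs : |inner ℝ u v| = |inner ℝ u v'| := by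
      simpa [norm_smul, hv, hv'] using congrArg norm h0
    rcases abs_eq_abs.1 habs with h | h
    · left
      rw [← h] at h0
      exact smul_right_injective _ hne h0
    · right
      have h' : inner ℝ u v' = -inner ℝ u v := by rw [h, neg_neg]
      rw [h', neg_smul, ← smul_neg] at h0
      exact smul_right_injective _ hne h0
  · set c := inner ℝ u v
    have hc1 : c ≤ 1 := by simpa [hu, hv] using real_inner_le_norm u v
    have hcomm : inner ℝ v u = c := real_inner_comm _ _
    have hFv := hF v
    rw [hTv, hv, mul_one] at hFv
    have hsq : ‖l • v - (D * c) • u‖ ^ 2 ≤ η ^ 2 := pow_le_pow_left₀ (norm_nonneg _) hFv 2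
    -- Pythagoras for the components orthogonal to `u` and along `u`.
    have hexp : ‖l • v - (D * c) • u‖ ^ 2 = l ^ 2 * (1 - c ^ 2) + (l * c - D * c) ^ 2 := by
      rw [← real_inner_self_eq_norm_sq]
      simp only [inner_sub_left, inner_sub_right, real_inner_smul_left, real_inner_smul_right,
        huu, hvv, hcomm]
      ring
    have hdist : ‖v - u‖ ^ 2 = 2 * (1 - c) := by
      rw [@norm_sub_sq_real, hu, hv, hcomm]; ring
    have h1 : l ^ 2 * (1 - c) ≤ η ^ 2 := by
      nlinarith [sq_nonneg (l * c - D * c), mul_nonneg (sq_nonneg l) (mul_nonneg hc (sub_nonneg.2 hc1))]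
    have h2 : (D - η) ^ 2 * (1 - c) ≤ η ^ 2 := by
      refine le_trans (mul_le_mul_of_nonneg_right ?_ (by linarith)) h1
      exact pow_le_pow_left₀ (by linarith) hDl 2
    have h3 : (2 * η) ^ 2 ≤ (r * (D - η)) ^ 2 := pow_le_pow_left₀ (by positivity) hr 2
    refine abs_le_of_sq_le_sq' ?_ hr0 |>.2
    rw [hdist]
    have hpos : 0 < (D - η) ^ 2 := by have : 0 < D - η := by linarith
                                      positivity
    refine le_of_mul_le_mul_left ?_ hpos
    nlinarith

end Perturbation

/-! ### Spectral norm concentration -/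

section Concentration

variable {n : ℕ} (P : EdgeProbMatrix n)

lemma isHermitian_adjacencyMatrix (ω : Sym2 (Fin n) → Bool) :
    (adjacencyMatrix ω).IsHermitian := by
  ext i j
  simp [adjacencyMatrix, Sym2.eq_swap]

lemma isHermitian_toMatrix : P.toMatrix.IsHermitian := by
  ext i j
  simp [P.symm' i j]

lemma norm_removeLoops_sub_le (x : EuclideanSpace ℝ (Fin n)) :
    ‖Matrix.toEuclideanLin (P.removeLoops.toMatrix - P.toMatrix) x‖ ≤ ‖x‖ := by
  have hcoord : ∀ i, Matrix.toEuclideanLin (P.removeLoops.toMatrix - P.toMatrix) x i =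
      -P.toMatrix i i * x i := fun i => by
    simp only [Matrix.toLpLin_apply, Matrix.mulVec, dotProduct, EdgeProbMatrix.removeLoops,
      Matrix.sub_apply, Matrix.of_apply]
    rw [Finset.sum_eq_single i (fun j _ hj => by simp [hj.symm]) (by simp)]
    simp
  refine abs_le_of_sq_le_sq' ?_ (norm_nonneg _) |>.2
  rw [EuclideanSpace.norm_sq_eq, EuclideanSpace.norm_sq_eq]
  refine Finset.sum_le_sum fun i _ => ?_
  rw [hcoord, norm_mul, norm_neg, mul_pow]
  refine mul_le_of_le_one_left (by positivity) (pow_le_one₀ (norm_nonneg _) ?_)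
  rw [Real.norm_eq_abs, abs_of_nonneg (P.mem_Icc' i i).1]
  exact (P.mem_Icc' i i).2

/-- Spectral norm concentration for random graphs with expected degrees at most `d`. -/
lemma le_graphLaw_norm_adjacencyMatrix_sub_le [NeZero n] {d δ : ℝ} (hd : 0 < d)
    (hrow : ∀ i, ∑ j, P.toMatrix i j ≤ d) (hδ : 0 < δ) (hδ1 : δ < 1)
    (hLd : 6 * Real.log (2 * n / δ) ≤ d) :
    1 - δ ≤ P.graphLaw.real {ω | ∀ x, ‖Matrix.toEuclideanLin (adjacencyMatrix ω - P.toMatrix) x‖ ≤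
      5 * √(4 * d * Real.log (2 * n / δ)) * ‖x‖} := by
  have hn : (1 : ℝ) ≤ n := by exact_mod_cast Nat.one_le_iff_ne_zero.2 (NeZero.ne n)
  have hq : 2 ≤ 2 * n / δ := by rw [le_div_iff₀ hδ]; nlinarith
  set L := Real.log (2 * n / δ) with hLdef
  have hL : 1 / 2 ≤ L := by
    have := Real.log_le_log (by norm_num) hq
    have := Real.log_two_gt_d9
    linarith
  set k := ⌈L⌉₊
  have hkL : L ≤ k := Nat.le_ceil L
  have hk3 : (k : ℝ) ≤ 3 * L := by
    have := Nat.ceil_lt_add_one (by linarith : 0 ≤ L)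
    linarith
  have hk0 : (0 : ℝ) < k := by linarith
  have hk : k ≠ 0 := by exact_mod_cast hk0.ne'
  set η := 5 * √(4 * d * L) with hη
  have hη2 : η ^ 2 = 100 * (d * L) := by
    rw [hη, mul_pow, Real.sq_sqrt (by positivity)]; ring
  set S := {ω | η ^ (2 * k) ≤ ((adjacencyMatrix ω - P.toMatrix) ^ (2 * k)).trace}
  have hHerm : ∀ ω, (adjacencyMatrix ω - P.toMatrix).IsHermitian := fun ω =>
    (isHermitian_adjacencyMatrix ω).sub (isHermitian_toMatrix P)
  have hmarkov : η ^ (2 * k) * P.graphLaw.real S ≤ n * (24 * (d * L)) ^ k := by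
    refine (mul_meas_ge_le_integral_of_nonneg (ae_of_all _ fun ω => ?_)
      (integrable_graphLaw P _) _).trans ?_
    · rw [trace_pow_eq_sum_eigenvalues_pow (hHerm ω)]
      exact Finset.sum_nonneg fun i _ => by rw [pow_mul]; positivity
    -- This `t` balances repeated and new edges, `t * d = 2 * k`; `t ≤ 1` holds because `2k ≤ 6L ≤
    -- d`.
    · refine (integral_trace_pow_le P hrow (t := 2 * k / d) (by positivity)
        (by rw [div_le_one hd]; linarith) k).trans ?_
      refine mul_le_mul_of_nonneg_left ?_ (by positivity)
      have : (((2 * k / d : ℝ) ^ k)⁻¹ * (2 * k + 2 * k / d * d) ^ (2 * k)) = (8 * k * d) ^ k := by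
        rw [pow_mul, ← inv_pow, ← mul_pow]
        congr 1
        field_simp
        ring
      rw [this]
      exact pow_le_pow_left₀ (by positivity) (by nlinarith) k
  have hS : P.graphLaw.real S ≤ δ := by
    have hdL : 0 < d * L := by positivity
    have hexp : Real.exp (-L) = δ / (2 * n) := by
      rw [Real.exp_neg, hLdef, Real.exp_log (by linarith), inv_div]
    -- The constant `5` makes the Markov ratio `24/100 < e⁻¹`, so `k ≥ L` powers of it beat the
    -- factor `n`.
    have h24 : (24 / 100 : ℝ) ^ k ≤ δ / (2 * n) := by
      calc (24 / 100 : ℝ) ^ k ≤ Real.exp (-1) ^ k := by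
            refine pow_le_pow_left₀ (by norm_num) ?_ k
            have := Real.exp_neg_one_gt_d9
            linarith
        _ = Real.exp (-k) := by rw [← Real.exp_nat_mul]; simp
        _ ≤ Real.exp (-L) := Real.exp_le_exp.2 (by linarith)
        _ = _ := hexp
    have hfac : (n : ℝ) * (24 * (d * L)) ^ k = η ^ (2 * k) * (n * (24 / 100) ^ k) := by
      rw [pow_mul, hη2, show 24 * (d * L) = 100 * (d * L) * (24 / 100) by ring, mul_pow]
      ring
    rw [hfac] at hmarkov
    have hηk : 0 < η ^ (2 * k) := by rw [pow_mul, hη2]; positivity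
    refine (le_of_mul_le_mul_left hmarkov hηk).trans ?_
    calc (n : ℝ) * (24 / 100) ^ k ≤ n * (δ / (2 * n)) :=
          mul_le_mul_of_nonneg_left h24 (by positivity)
      _ = δ / 2 := by field_simp
      _ ≤ δ := by linarith
  calc 1 - δ ≤ 1 - P.graphLaw.real S := by linarith
    _ = P.graphLaw.real Sᶜ := (probReal_compl_eq_one_sub (Set.toFinite S).measurableSet).symm
    _ ≤ _ := measureReal_mono fun ω hω x =>
        norm_toEuclideanLin_le_of_trace_pow_le (hHerm ω) hk (by positivity)
          (le_of_lt (not_le.1 hω)) x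

end Concentration

/-! ### Application to `G(w)` -/

section GWModel

variable {n : ℕ} [NeZero n] {w : EuclideanSpace ℝ (Fin n)}

lemma IsExpectedDegreeSequence.sum_pos (hw : IsExpectedDegreeSequence w) : 0 < ∑ k, w k :=
  Finset.sum_pos (fun k _ => hw.pos k) Finset.univ_nonempty

lemma IsExpectedDegreeSequence.norm_pos (hw : IsExpectedDegreeSequence w) : 0 < ‖w‖ :=
  norm_pos_iff.2 fun h => (hw.pos 0).ne' (by simp [h])

lemma IsExpectedDegreeSequence.sum_sq_div_sum_le (hw : IsExpectedDegreeSequence w) :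
    (∑ i, w i ^ 2) / ∑ i, w i ≤ w 0 := by
  rw [div_le_iff₀ hw.sum_pos, Finset.mul_sum]
  refine Finset.sum_le_sum fun i _ => ?_
  rw [sq]
  exact mul_le_mul_of_nonneg_right (hw.antitone 0 i (Fin.zero_le i)) (hw.pos i).le

lemma sum_gwModel_le (hw : IsExpectedDegreeSequence w) (i : Fin n) :
    ∑ j, (gwModel w hw).toMatrix i j ≤ w 0 := by
  have hs := hw.sum_pos
  simp only [gwModel, Matrix.of_apply]
  rw [← Finset.sum_div, ← Finset.mul_sum, mul_div_assoc, div_self hs.ne', mul_one]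
  exact hw.antitone 0 i (Fin.zero_le i)

lemma toEuclideanLin_gwModel (hw : IsExpectedDegreeSequence w) (x : EuclideanSpace ℝ (Fin n)) :
    Matrix.toEuclideanLin (gwModel w hw).toMatrix x =
      ((∑ i, w i ^ 2) / (∑ i, w i) * inner ℝ (‖w‖⁻¹ • w) x) • (‖w‖⁻¹ • w) := by
  have hs := hw.sum_pos
  have hw0 := hw.norm_pos
  have hsq : ∑ i, w i ^ 2 = ‖w‖ ^ 2 := by simp [EuclideanSpace.norm_sq_eq]
  have hin : inner ℝ w x = ∑ j, w j * x j := by simp [PiLp.inner_apply, mul_comm]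
  ext i
  rw [hsq, real_inner_smul_left, hin]
  have : (Matrix.toEuclideanLin (gwModel w hw).toMatrix x) i =
      w i / (∑ k, w k) * ∑ j, w j * x j := by
    simp only [gwModel, Matrix.toLpLin_apply, Matrix.mulVec, dotProduct, Matrix.of_apply,
      Finset.mul_sum]
    exact Finset.sum_congr rfl fun j _ => by ring
  rw [this]
  simp only [PiLp.smul_apply, smul_eq_mul]
  field_simp

/-- Concentration of the top eigenvector for every edge probability matrix at spectral distance at
most one from that of `G(w)`, with expected degrees at most `w 0`. -/
lemma le_graphLaw_topEigenvectorWithin (hw : IsExpectedDegreeSequence w) {ε δ : ℝ}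
    (hconc : GWConcentration w ε δ) (P : EdgeProbMatrix n)
    (hrow : ∀ i, ∑ j, P.toMatrix i j ≤ w 0)
    (hP : ∀ x, ‖Matrix.toEuclideanLin (P.toMatrix - (gwModel w hw).toMatrix) x‖ ≤ ‖x‖) :
    1 - δ ≤ P.graphLaw.real
      {ω | TopEigenvectorWithin (adjacencyMatrix ω) (‖w‖⁻¹ • w) (ε / 8)} := by
  obtain ⟨hε0, hε1⟩ := hconc.eps_mem
  have hd := hw.pos 0
  set D := (∑ i, w i ^ 2) / ∑ i, w i with hD
  set Δ := √(4 * w 0 * Real.log (2 * n / δ)) with hΔ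
  have hΔ0 : 0 ≤ Δ := Real.sqrt_nonneg _
  have hDε : 256 * (Δ + 1) ≤ D * ε ^ 2 := (div_le_iff₀ (by positivity)).1
    hconc.le_second_order_average
  have hD0 : 0 < D := by
    by_contra h
    nlinarith [sq_nonneg ε]
  have hDε1 : D * ε ^ 2 ≤ D * ε := by
    refine mul_le_mul_of_nonneg_left ?_ hD0.le
    nlinarith
  have hDD : D * ε ≤ D := by nlinarith
  -- Since `256 Δ ≤ d̃ ≤ w₁`, squaring gives far more than `6L ≤ w₁`.
  have hLd : 6 * Real.log (2 * n / δ) ≤ w 0 := by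
    rcases le_or_gt (Real.log (2 * n / δ)) 0 with hL | hL
    · linarith
    · have hsq : Δ ^ 2 = 4 * w 0 * Real.log (2 * n / δ) := Real.sq_sqrt (by positivity)
      have hΔw : 256 * Δ ≤ w 0 := by linarith [hw.sum_sq_div_sum_le]
      refine le_of_mul_le_mul_left ?_ hd
      nlinarith
  refine (le_graphLaw_norm_adjacencyMatrix_sub_le P hd hrow hconc.delta_mem.1
    hconc.delta_mem.2 hLd).trans (measureReal_mono fun ω hω => ?_)
  refine topEigenvectorWithin_of_rank_one_perturbation (D := D) (η := 5 * Δ + 1)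
    (isHermitian_adjacencyMatrix ω) ?_ (by linarith) (by positivity) ?_ fun x => ?_
  · rw [norm_smul, norm_inv, norm_norm, inv_mul_cancel₀ hw.norm_pos.ne']
  · have : ε * (5 * Δ + 1) ≤ 5 * Δ + 1 := mul_le_of_le_one_left (by positivity) hε1.le
    linarith
  · rw [← toEuclideanLin_gwModel hw]
    have hsplit : Matrix.toEuclideanLin (adjacencyMatrix ω) x -
        Matrix.toEuclideanLin (gwModel w hw).toMatrix x =
        Matrix.toEuclideanLin (adjacencyMatrix ω - P.toMatrix) x +
        Matrix.toEuclideanLin (P.toMatrix - (gwModel w hw).toMatrix) x := by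
      simp only [map_sub, LinearMap.sub_apply]
      abel
    rw [hsplit, add_mul, one_mul]
    exact (norm_add_le _ _).trans (add_le_add (hω x) (hP x))

end GWModel

theorem mainTheorem10 {n : ℕ} [NeZero n] (w : EuclideanSpace ℝ (Fin n))
    (hw : IsExpectedDegreeSequence w) (ε δ : ℝ) (hconc : GWConcentration w ε δ) :
    1 - δ ≤ (gwModel w hw).graphLaw.real
        {ω | TopEigenvectorWithin (adjacencyMatrix ω) (‖w‖⁻¹ • w) (ε / 8)} ∧
      1 - δ ≤ (gwModel w hw).removeLoops.graphLaw.real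
        {ω | TopEigenvectorWithin (adjacencyMatrix ω) (‖w‖⁻¹ • w) (ε / 8)} := by
  refine ⟨le_graphLaw_topEigenvectorWithin hw hconc _ (sum_gwModel_le hw) fun x => by simp,
    le_graphLaw_topEigenvectorWithin hw hconc _ (fun i => ?_) (norm_removeLoops_sub_le _)⟩
  -- Deleting loops only lowers row sums.
  refine (Finset.sum_le_sum fun j _ => ?_).trans (sum_gwModel_le hw i)
  by_cases h : i = j
  · simpa [EdgeProbMatrix.removeLoops, h] using ((gwModel w hw).mem_Icc' j j).1
  · simp [EdgeProbMatrix.removeLoops, h]
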